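/- Let $n,m\ge 1$ be integers, let $A_0,\dots,A_m$ be complex $n\times n$ matrices, let $\tau_0,\dots,\tau_m>0$, and put $$F(s)=I_n-\sum_{k=0}^m A_k e^{-s\tau_k}\qquad(s\in\mathbb C).$$ Let $\sigma>0$, and suppose that $\det F$ has infinitely many zeros in the half-plane $\{s\in\mathbb C : \operatorname{Re} s>\sigma\}$. Let $\Omega\subseteq\mathbb C$ be an open set that contains, for some $R\in\mathbb R$, all $s$ with $\operatorname{Re} s>0$ and $|s|>R$ (for instance $\Omega=\{\operatorname{Re}s>0\}$ or $\Omega=\mathbb C$). Let $H$ be a holomorphic function on $\Omega$ with values in the complex $n\times n$ matrices such that $|H(s)|\to 0$ as $|s|\to+\infty$ with $\operatorname{Re} s>0$. Then $\det(F+H)$ has infinitely many zeros in $\Omega$ with strictly positive real part. -/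

import Mathlib

/-- The open half-plane `P_σ = {s ∈ ℂ | Re s > σ}`. -/
def rightHalfPlane (σ : ℝ) : Set ℂ := {s : ℂ | σ < s.re}

/-- The matrix exponential polynomial `F(s) = I_n - ∑_{k=0}^m A_k e^{-s τ_k}`. -/
noncomputable def expPolyMatrix {n m : ℕ} (A : Fin (m + 1) → Matrix (Fin n) (Fin n) ℂ)
    (τ : Fin (m + 1) → ℝ) (s : ℂ) : Matrix (Fin n) (Fin n) ℂ :=
  1 - ∑ k, Complex.exp (-s * (τ k : ℂ)) • A k

/-- A matrix-valued function is holomorphic on an open set `Ω` when all its entries are. -/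
def MatrixHolomorphicOn {n : ℕ} (H : ℂ → Matrix (Fin n) (Fin n) ℂ) (Ω : Set ℂ) : Prop :=
  ∀ i j, DifferentiableOn ℂ (fun s => H s i j) Ω

open Filter Topology

/-! Since `F → I` as `Re s → ∞`, the given zeros of `det F` lie in a strip `σ ≤ Re s ≤ B`; being
isolated, they have unbounded imaginary parts. Translating by `i Im s` only multiplies each
`e^{-zτ_k}` by a unimodular phase. By compactness the phases and real parts of the zeros have a
limit `(u, x)` with `x > 0`, and `G(z) = det (I - ∑ u_k e^{-zτ_k} A_k)` vanishes at `x` but not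
identically. On a small circle around `x`, `|G|` is bounded below, and the translates of `det (F +
H)` are close to `G` on the circle and at its centre. The maximum principle for the reciprocal then
gives a zero in the disc (`exists_zero_of_norm_center_lt_norm_sphere`), arbitrarily far out. -/

/-- The matrix `I - ∑ v_k A_k`. -/
noncomputable def oneSubSumSmul {n m : ℕ} (A : Fin (m + 1) → Matrix (Fin n) (Fin n) ℂ)
    (v : Fin (m + 1) → ℂ) : Matrix (Fin n) (Fin n) ℂ :=
  1 - ∑ k, v k • A k

theorem continuous_oneSubSumSmul {n m : ℕ} (A : Fin (m + 1) → Matrix (Fin n) (Fin n) ℂ) :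
    Continuous (oneSubSumSmul A) := by
  unfold oneSubSumSmul
  fun_prop

theorem DifferentiableOn.matrix_det {n : ℕ} {M : ℂ → Matrix (Fin n) (Fin n) ℂ} {S : Set ℂ}
    (hM : ∀ i j, DifferentiableOn ℂ (fun s => M s i j) S) :
    DifferentiableOn ℂ (fun s => (M s).det) S := by
  simp only [Matrix.det_apply]
  refine DifferentiableOn.fun_sum fun p _ => DifferentiableOn.fun_const_smul ?_ _
  exact DifferentiableOn.fun_finsetProd fun i _ => hM _ _

theorem differentiable_oneSubSumSmul_exp {n m : ℕ} (A : Fin (m + 1) → Matrix (Fin n) (Fin n) ℂ)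
    (τ : Fin (m + 1) → ℝ) (u : Fin (m + 1) → ℂ) (i j : Fin n) :
    Differentiable ℂ (fun z : ℂ =>
      oneSubSumSmul A (fun k => u k * Complex.exp (-z * (τ k : ℂ))) i j) := by
  simp only [oneSubSumSmul, Matrix.sub_apply, Matrix.sum_apply, Matrix.smul_apply, smul_eq_mul]
  fun_prop

theorem expPolyMatrix_eq_oneSubSumSmul {n m : ℕ} (A : Fin (m + 1) → Matrix (Fin n) (Fin n) ℂ)
    (τ : Fin (m + 1) → ℝ) (z : ℂ) (y : ℝ) :
    expPolyMatrix A τ (z + y * Complex.I) =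
      oneSubSumSmul A (fun k => Complex.exp (((-y * τ k : ℝ) : ℂ) * Complex.I) *
        Complex.exp (-z * (τ k : ℂ))) := by
  unfold expPolyMatrix oneSubSumSmul
  congr 1
  refine Finset.sum_congr rfl fun k _ => ?_
  dsimp only
  rw [← Complex.exp_add]
  congr 2
  push_cast
  ring

theorem norm_exp_neg_mul_ofReal (z : ℂ) (t : ℝ) :
    ‖Complex.exp (-z * (t : ℂ))‖ = Real.exp (-(z.re * t)) := by
  simp [Complex.norm_exp]

/-- Far to the right, `det (I - ∑ u_k e^{-zτ_k} A_k)` does not vanish, uniformly in unimodular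
coefficients `u`. -/
theorem exists_det_oneSubSumSmul_exp_ne_zero {n m : ℕ}
    (A : Fin (m + 1) → Matrix (Fin n) (Fin n) ℂ) (τ : Fin (m + 1) → ℝ) (hτ : ∀ k, 0 < τ k) :
    ∃ B : ℝ, ∀ u : Fin (m + 1) → ℂ, (∀ k, ‖u k‖ = 1) → ∀ z : ℂ, B ≤ z.re →
      (oneSubSumSmul A (fun k => u k * Complex.exp (-z * (τ k : ℂ)))).det ≠ 0 := by
  have h0 : ∀ᶠ v in 𝓝 (0 : Fin (m + 1) → ℂ), (oneSubSumSmul A v).det ≠ 0 := by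
    have hc : Continuous fun v => (oneSubSumSmul A v).det :=
      (continuous_oneSubSumSmul A).matrix_det
    refine hc.continuousAt.eventually_ne ?_
    simp [oneSubSumSmul]
  obtain ⟨ε, hε, hball⟩ := Metric.eventually_nhds_iff.1 h0
  have hx : ∀ᶠ x : ℝ in atTop, ∀ k, Real.exp (-(x * τ k)) < ε := by
    refine eventually_all.2 fun k => ?_
    have : Tendsto (fun x : ℝ => Real.exp (-(x * τ k))) atTop (𝓝 0) :=
      Real.tendsto_exp_neg_atTop_nhds_zero.comp (tendsto_id.atTop_mul_const (hτ k))
    exact this.eventually_lt_const hε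
  obtain ⟨B, hB⟩ := eventually_atTop.1 hx
  refine ⟨B, fun u hu z hz => hball ?_⟩
  rw [dist_zero_right, pi_norm_lt_iff hε]
  intro k
  rw [norm_mul, hu, one_mul, norm_exp_neg_mul_ofReal]
  exact hB _ hz k

theorem norm_exp_phase (y t : ℝ) :
    ‖Complex.exp (((-y * t : ℝ) : ℂ) * Complex.I)‖ = 1 :=
  Complex.norm_exp_ofReal_mul_I _

/-- The zeros of `det (I - ∑ u_k e^{-zτ_k} A_k)` are isolated. -/
theorem eventually_det_oneSubSumSmul_exp_ne_zero {n m : ℕ}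
    (A : Fin (m + 1) → Matrix (Fin n) (Fin n) ℂ) (τ : Fin (m + 1) → ℝ) (hτ : ∀ k, 0 < τ k)
    (u : Fin (m + 1) → ℂ) (hu : ∀ k, ‖u k‖ = 1) (x : ℂ) :
    ∀ᶠ z in 𝓝[≠] x,
      (oneSubSumSmul A (fun k => u k * Complex.exp (-z * (τ k : ℂ)))).det ≠ 0 := by
  obtain ⟨B, hB⟩ := exists_det_oneSubSumSmul_exp_ne_zero A τ hτ
  have hd : DifferentiableOn ℂ (fun z : ℂ =>
      (oneSubSumSmul A (fun k => u k * Complex.exp (-z * (τ k : ℂ)))).det) Set.univ :=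
    DifferentiableOn.matrix_det fun i j =>
      (differentiable_oneSubSumSmul_exp A τ u i j).differentiableOn
  -- Otherwise the identity theorem forces the determinant to vanish everywhere, even far to the
  -- right.
  by_contra hne
  have hfr := not_eventually.1 hne
  simp only [not_not] at hfr
  have := (hd.analyticOnNhd isOpen_univ).eqOn_zero_of_preconnected_of_frequently_eq_zero
    isPreconnected_univ (Set.mem_univ x) hfr (Set.mem_univ (B : ℂ))
  exact hB u hu (B : ℂ) (by simp) this

theorem oneSubSumSmul_one_exp {n m : ℕ} (A : Fin (m + 1) → Matrix (Fin n) (Fin n) ℂ)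
    (τ : Fin (m + 1) → ℝ) (z : ℂ) :
    oneSubSumSmul A (fun k => (1 : ℂ) * Complex.exp (-z * (τ k : ℂ))) = expPolyMatrix A τ z := by
  simp [oneSubSumSmul, expPolyMatrix]

theorem finite_zeros_det_expPolyMatrix_closedBall {n m : ℕ}
    (A : Fin (m + 1) → Matrix (Fin n) (Fin n) ℂ) (τ : Fin (m + 1) → ℝ) (hτ : ∀ k, 0 < τ k)
    (R : ℝ) : {s ∈ Metric.closedBall (0 : ℂ) R | (expPolyMatrix A τ s).det = 0}.Finite := by
  by_contra hinf
  obtain ⟨x, -, hx⟩ := Set.Infinite.exists_accPt_of_subset_isCompact hinf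
    (isCompact_closedBall (0 : ℂ) R) (Set.sep_subset _ _)
  have h1 := eventually_det_oneSubSumSmul_exp_ne_zero A τ hτ (fun _ => 1) (by simp) x
  simp only [oneSubSumSmul_one_exp] at h1
  exact (accPt_iff_frequently_nhdsNE.1 hx) (h1.mono fun z hz hz' => hz hz'.2)

/-- A holomorphic function which is smaller at the centre of a disc than on the boundary circle
has a zero in the closed disc. -/
theorem exists_zero_of_norm_center_lt_norm_sphere {g : ℂ → ℂ} {c : ℂ} {r δ : ℝ} (hr : 0 < r)
    (hδ : 0 < δ) (hg : DifferentiableOn ℂ g (Metric.closedBall c r)) (hc : ‖g c‖ < δ)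
    (hs : ∀ z ∈ Metric.sphere c r, δ ≤ ‖g z‖) : ∃ z ∈ Metric.closedBall c r, g z = 0 := by
  by_contra! hne
  have hd : DifferentiableOn ℂ (fun z => (g z)⁻¹) (closure (Metric.ball c r)) := by
    rw [closure_ball c hr.ne']
    exact hg.fun_inv hne
  have hle : ‖(g c)⁻¹‖ ≤ δ⁻¹ := by
    refine Complex.norm_le_of_forall_mem_frontier_norm_le (f := fun z => (g z)⁻¹)
      Metric.isBounded_ball hd.diffContOnCl (fun z hz => ?_)
      (subset_closure (Metric.mem_ball_self hr))
    rw [frontier_ball c hr.ne'] at hz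
    rw [norm_inv]
    exact inv_anti₀ hδ (hs z hz)
  rw [norm_inv, inv_le_inv₀ (norm_pos_iff.2 (hne c (Metric.mem_closedBall_self hr.le))) hδ] at hle
  exact hle.not_gt hc

theorem mainTheorem5 {n m : ℕ}
    (A : Fin (m + 1) → Matrix (Fin n) (Fin n) ℂ)
    (τ : Fin (m + 1) → ℝ) (hτ : ∀ k, 0 < τ k)
    (σ : ℝ) (hσ : 0 < σ)
    (hF : {s ∈ rightHalfPlane σ | (expPolyMatrix A τ s).det = 0}.Infinite)
    (Ω : Set ℂ) (hΩ : IsOpen Ω)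
    (hΩR : ∃ R : ℝ, ∀ s ∈ rightHalfPlane 0, R < ‖s‖ → s ∈ Ω)
    (H : ℂ → Matrix (Fin n) (Fin n) ℂ) (hH : MatrixHolomorphicOn H Ω)
    (hH0 : Filter.Tendsto H
      (Bornology.cobounded ℂ ⊓ Filter.principal (rightHalfPlane 0)) (nhds 0)) :
    {s ∈ Ω | 0 < s.re ∧ (expPolyMatrix A τ s + H s).det = 0}.Infinite := by
  intro hfin
  obtain ⟨R, hR⟩ := hΩR
  obtain ⟨R₁, hR₁⟩ := hfin.isBounded.exists_norm_le
  obtain ⟨B, hB⟩ := exists_det_oneSubSumSmul_exp_ne_zero A τ hτ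
  set Z := {s ∈ rightHalfPlane σ | (expPolyMatrix A τ s).det = 0} with hZ
  -- the phases of a point, normalised so that translation by `i Im s` multiplies by them
  let phase : ℂ → Fin (m + 1) → ℂ :=
    fun s k => Complex.exp (((-s.im * τ k : ℝ) : ℂ) * Complex.I)
  have hphase : ∀ s k, ‖phase s k‖ = 1 := fun s k => norm_exp_phase _ _
  have hZre : ∀ s ∈ Z, s.re ∈ Set.Icc σ B := by
    rintro s ⟨hs, hs0⟩
    refine ⟨le_of_lt hs, le_of_not_ge fun hle => ?_⟩
    refine hB (fun _ => 1) (by simp) s hle ?_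
    rw [oneSubSumSmul_one_exp, hs0]
  have : NeBot (cofinite ⊓ 𝓟 Z) := hF.cofinite_inf_principal_neBot
  let U : Ultrafilter ℂ := Ultrafilter.of (cofinite ⊓ 𝓟 Z)
  have hU : (U : Filter ℂ) ≤ cofinite ⊓ 𝓟 Z := Ultrafilter.of_le _
  have hUZ : ∀ᶠ s in (U : Filter ℂ), s ∈ Z := hU (mem_inf_of_right (mem_principal_self Z))
  have hUim : ∀ C : ℝ, ∀ᶠ s in (U : Filter ℂ), C < |s.im| := by
    intro C
    -- As `0 < Re s ≤ B`, a zero with `|s| > B + C` has `|Im s| > C`.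
    have h1 := (finite_zeros_det_expPolyMatrix_closedBall A τ hτ (B + C)).compl_mem_cofinite
    filter_upwards [hUZ, hU (mem_inf_of_left h1)] with s hs hs'
    have hsn : B + C < ‖s‖ := by
      by_contra! hle
      exact hs' ⟨by simpa using hle, hs.2⟩
    have h2 := Complex.norm_le_abs_re_add_abs_im s
    have h3 := hZre s hs
    rw [abs_of_pos (hσ.trans_le h3.1)] at h2
    linarith [h3.2]
  have hK : IsCompact ((Set.pi Set.univ fun _ : Fin (m + 1) => Metric.sphere (0 : ℂ) 1) ×ˢ
      Set.Icc σ B) :=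
    (isCompact_univ_pi fun _ => isCompact_sphere _ _).prod isCompact_Icc
  obtain ⟨⟨u, x⟩, ⟨hu, hx⟩, hle⟩ := hK.ultrafilter_le_nhds
    (U.map fun s => (phase s, s.re)) (by
      rw [Ultrafilter.coe_map, le_principal_iff, mem_map]
      filter_upwards [hUZ] with s hs
      exact ⟨fun k _ => by simpa using hphase s k, hZre s hs⟩)
  have hlim : Tendsto (fun s => (phase s, s.re)) U (𝓝 (u, x)) := hle
  have hu1 : ∀ k, ‖u k‖ = 1 := fun k => by simpa using hu k (Set.mem_univ k)
  have hlimu : Tendsto phase U (𝓝 u) := (continuous_fst.tendsto _).comp hlim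
  have hx0 : 0 < x := hσ.trans_le hx.1
  -- Point, phases and perturbation are independent variables, so closeness to the limit function is
  -- joint continuity at `(z, u, 0)`.
  let Φ : ℂ × (Fin (m + 1) → ℂ) × Matrix (Fin n) (Fin n) ℂ → ℂ := fun p =>
    (oneSubSumSmul A (fun k => p.2.1 k * Complex.exp (-p.1 * (τ k : ℂ))) + p.2.2).det
  have hΦ : Continuous Φ := by
    refine Continuous.matrix_det (Continuous.add ?_ (by fun_prop))
    exact (continuous_oneSubSumSmul A).comp (by fun_prop)
  have htrans : ∀ (s z : ℂ) (M : Matrix (Fin n) (Fin n) ℂ),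
      Φ (z, phase s, M) = (expPolyMatrix A τ (z + s.im * Complex.I) + M).det := by
    intro s z M
    rw [expPolyMatrix_eq_oneSubSumSmul]
  have hΦx : Φ (x, u, 0) = 0 := by
    have hc : Continuous fun p : (Fin (m + 1) → ℂ) × ℝ => Φ ((p.2 : ℂ), p.1, 0) :=
      hΦ.comp (by fun_prop)
    refine tendsto_nhds_unique ((hc.tendsto (u, x)).comp hlim) ?_
    refine tendsto_const_nhds.congr' ?_
    filter_upwards [hUZ] with s hs
    simp only [Function.comp_apply]
    rw [htrans, add_zero, Complex.re_add_im, hs.2]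
  -- a circle around `x` in the right half-plane on which the limit does not vanish
  obtain ⟨r, hr, hrx, hsph⟩ : ∃ r : ℝ, 0 < r ∧ r < x ∧
      ∀ z ∈ Metric.sphere (x : ℂ) r, Φ (z, u, 0) ≠ 0 := by
    have h1 := eventually_det_oneSubSumSmul_exp_ne_zero A τ hτ u hu1 x
    obtain ⟨ε, hε, h2⟩ := Metric.eventually_nhds_iff.1 (eventually_nhdsWithin_iff.1 h1)
    -- `ε / 2` keeps the circle where `x` is the only possible zero; `x / 2` keeps the disc in `Re z
    -- > 0`.
    refine ⟨min (ε / 2) (x / 2), by positivity, (min_le_right _ _).trans_lt (by linarith), ?_⟩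
    intro z hz
    rw [Metric.mem_sphere] at hz
    have hzx : z ≠ x := by
      rw [← dist_pos, hz]
      positivity
    have := h2 (hz.trans_lt ((min_le_left _ _).trans_lt (by linarith))) hzx
    simpa [Φ] using this
  obtain ⟨δ, hδ, hδs⟩ : ∃ δ : ℝ, 0 < δ ∧
      ∀ z ∈ Metric.sphere (x : ℂ) r, δ < ‖Φ (z, u, 0)‖ := by
    obtain ⟨z₀, hz₀, hmin⟩ := (isCompact_sphere (x : ℂ) r).exists_isMinOn
      (NormedSpace.sphere_nonempty.2 hr.le)
      (f := fun z => ‖Φ (z, u, 0)‖) (Continuous.continuousOn (by fun_prop))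
    have hp := norm_pos_iff.2 (hsph z₀ hz₀)
    exact ⟨‖Φ (z₀, u, 0)‖ / 2, by positivity, fun z hz =>
      (half_lt_self hp).trans_le (hmin hz)⟩
  have hnear_sphere : ∀ᶠ q in 𝓝 (u, (0 : Matrix (Fin n) (Fin n) ℂ)),
      ∀ z ∈ Metric.sphere (x : ℂ) r, δ < ‖Φ (z, q)‖ := by
    refine (isCompact_sphere (x : ℂ) r).eventually_forall_of_forall_eventually fun z hz => ?_
    have hc : Continuous fun p : ((Fin (m + 1) → ℂ) × Matrix (Fin n) (Fin n) ℂ) × ℂ =>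
        ‖Φ (p.2, p.1)‖ := by fun_prop
    exact hc.continuousAt.eventually_const_lt (hδs z hz)
  have hnear_center : ∀ᶠ q in 𝓝 (u, (0 : Matrix (Fin n) (Fin n) ℂ)), ‖Φ (x, q)‖ < δ := by
    have hc : Continuous fun q : (Fin (m + 1) → ℂ) × Matrix (Fin n) (Fin n) ℂ =>
        ‖Φ (x, q)‖ := by fun_prop
    refine hc.continuousAt.eventually_lt_const ?_
    simpa only [hΦx, norm_zero] using hδ
  rw [nhds_prod_eq] at hnear_sphere hnear_center
  -- Separating the conditions on phases and perturbation lets the perturbation be `H (z + i Im s)`,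
  -- which varies with `z`.
  obtain ⟨p, hp, p', hp', hpp⟩ := eventually_prod_iff.1 (hnear_sphere.and hnear_center)
  obtain ⟨R₂, hR₂⟩ : ∃ R₂ : ℝ, ∀ w ∈ rightHalfPlane 0, R₂ < ‖w‖ → p' (H w) := by
    have h1 := eventually_inf_principal.1 (hH0.eventually hp')
    rw [← comap_norm_atTop, eventually_comap] at h1
    obtain ⟨R₂, h2⟩ := eventually_atTop.1 h1
    exact ⟨R₂, fun w hw hw' => h2 _ hw'.le w rfl hw⟩
  -- The disc lowers `|Im|` by at most `r`; beyond `R` lies `Ω`, beyond `R₁` no zeros remain, beyond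
  -- `R₂` `H` is small.
  obtain ⟨s, hsim, hsp⟩ :=
    ((hUim (r + max R (max R₁ R₂))).and (hlimu.eventually hp)).exists
  have hball : ∀ z ∈ Metric.closedBall (x : ℂ) r,
      z + s.im * Complex.I ∈ rightHalfPlane 0 ∧
        max R (max R₁ R₂) < ‖z + s.im * Complex.I‖ := by
    intro z hz
    rw [Metric.mem_closedBall, Complex.dist_eq] at hz
    have hre := (Complex.abs_re_le_norm (z - x)).trans hz
    have him := (Complex.abs_im_le_norm (z - x)).trans hz
    simp only [Complex.sub_re, Complex.ofReal_re, Complex.sub_im, Complex.ofReal_im, sub_zero]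
      at hre him
    constructor
    · have := (abs_le.1 hre).1
      simp only [rightHalfPlane, Set.mem_ofPred_eq, Complex.add_re, Complex.mul_re,
        Complex.ofReal_re, Complex.I_re, Complex.ofReal_im, Complex.I_im]
      linarith
    · have h1 := Complex.abs_im_le_norm (z + s.im * Complex.I)
      have h2 : (z + s.im * Complex.I).im = z.im + s.im := by simp
      rw [h2] at h1
      have h3 := abs_sub_abs_le_abs_sub s.im (-z.im)
      rw [abs_neg, sub_neg_eq_add, add_comm s.im] at h3
      linarith
  have hΩball : ∀ z ∈ Metric.closedBall (x : ℂ) r, z + s.im * Complex.I ∈ Ω := fun z hz =>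
    hR _ (hball z hz).1 ((le_max_left _ _).trans_lt (hball z hz).2)
  have hHball : ∀ z ∈ Metric.closedBall (x : ℂ) r, p' (H (z + s.im * Complex.I)) := fun z hz =>
    hR₂ _ (hball z hz).1
      (((le_max_right _ _).trans (le_max_right _ _)).trans_lt (hball z hz).2)
  have hdiff : DifferentiableOn ℂ
      (fun z => Φ (z, phase s, H (z + s.im * Complex.I))) (Metric.closedBall (x : ℂ) r) := by
    refine DifferentiableOn.matrix_det fun i j => ?_
    refine DifferentiableOn.fun_add
      (differentiable_oneSubSumSmul_exp A τ (phase s) i j).differentiableOn ?_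
    exact (hH i j).comp (by fun_prop) hΩball
  obtain ⟨z, hz, hz0⟩ := exists_zero_of_norm_center_lt_norm_sphere hr hδ hdiff
    (hpp hsp (hHball x (Metric.mem_closedBall_self hr.le))).2
    fun z hz => ((hpp hsp (hHball z (Metric.sphere_subset_closedBall hz))).1 z hz).le
  simp only [htrans] at hz0
  have hle := hR₁ _ ⟨hΩball z hz, (hball z hz).1, hz0⟩
  exact hle.not_gt (((le_max_left _ _).trans (le_max_right _ _)).trans_lt (hball z hz).2)
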